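/- Let $\mathcal L$ be a relational first-order language and let $\mathbf M$ be a Fraïssé limit in $\mathcal L$, i.e. a countable ultrahomogeneous $\mathcal L$-structure; $\mathrm{Age}(\mathbf M)$ is the class of finite $\mathcal L$-structures that embed into $\mathbf M$. Say that $\mathbf M$ has the free amalgamation property if for all $\mathbf A,\mathbf B_1,\mathbf B_2\in\mathrm{Age}(\mathbf M)$ and all embeddings $f_i\colon\mathbf A\hookrightarrow\mathbf B_i$ ($i=1,2$) there are $\mathbf C\in\mathrm{Age}(\mathbf M)$ and embeddings $g_i\colon\mathbf B_i\hookrightarrow\mathbf C$ such that (i) $g_1\circ f_1=g_2\circ f_2$; (ii) whenever $g_1(b_1)=g_2(b_2)$, there is $a\in\mathbf A$ with $f_1(a)=b_1$ and $f_2(a)=b_2$; (iii) whenever $R^{\mathbf C}(\bar c)$ holds for some $R\in\mathcal L$, all entries of $\bar c$ lie in $g_1(\mathbf B_1)$ or all of them lie in $g_2(\mathbf B_2)$. Let $\Omega$ be the domain of $\mathbf M$ and let $G=\mathrm{Aut}(\mathbf M)\le\mathrm{Sym}(\Omega)$ carry the topology of pointwise convergence ($\Omega$ discrete). For $A\subseteq\Omega$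 let $G_A$ be the pointwise stabilizer of $A$. **Theorem.** If $\mathbf M$ is a Fraïssé limit with the free amalgamation property, then $\mathrm{Aut}(\mathbf M)$ is dissociated, that is: 1. for every strongly continuous unitary representation $\pi$ of $G$ on a complex Hilbert space $\mathcal H$ and all finite $A,B\subseteq\Omega$, one has $p_Ap_B=p_{A\cap B}$, where $p_A$ is the orthogonal projection onto the space $\mathcal H_A$ of $\pi(G_A)$-invariant vectors; and 2. for every Boolean p.m.p. action of $G$ on a standard probability space $(X,\mu)$ (a homomorphism $G\to\mathrm{Aut}(X,\mu)$, continuous for the weak topology, where automorphisms that agree almost everywhere are identified) and all finite $A,B\subseteq\Omega$, the $\sigma$-algebras $\mathcal F_A$ and $\mathcal F_B$ are independent conditionally on $\mathcal F_{A\cap B}$, i.e. $\mathbb E[f\mid\mathcal F_A]=\mathbb E[f\mid\mathcal F_{A\cap B}]$ for every $\mathcal F_B$-measurable $f\in L^2(X,\mu)$; here $\mathcal F_A$ is the $\sigma$-algebra of measurable $Y\subseteq X$ with $\mu(gY\mathbin{\triangle}Y)=0$ for all $g\in G_A$. Moreover, there is a Fraïssé limit $\mathbf M$ in a relational language which has the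 free amalgamation property and whose automorphism group is not Roelcke precompact, i.e. for which there is a neighbourhood $U$ of the identity in $\mathrm{Aut}(\mathbf M)$ such that $\mathrm{Aut}(\mathbf M)\neq UFU$ for every finite $F\subseteq\mathrm{Aut}(\mathbf M)$. -/

import Mathlib

open MeasureTheory Filter Topology CategoryTheory
open scoped FirstOrder Pointwise symmDiff

universe u v w uH uX

namespace Dissociation

/-- The topology of pointwise convergence on `Sym(Ω)`, where `Ω` is discrete. -/
instance permTopology (Ω : Type*) : TopologicalSpace (Equiv.Perm Ω) :=
  TopologicalSpace.induced (fun g : Equiv.Perm Ω => (g : Ω → Ω))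
    (@Pi.topologicalSpace Ω (fun _ => Ω) (fun _ => ⊥))

/-! ### Unitary representations -/

/-- A unitary representation: a homomorphism to the unitary group which is continuous for the
strong operator topology. -/
structure UnitaryRep (G : Type*) [Group G] [TopologicalSpace G]
    (H : Type*) [NormedAddCommGroup H] [InnerProductSpace ℂ H] where
  toHom : G →* (H ≃ₗᵢ[ℂ] H)
  continuous_apply : ∀ ξ : H, Continuous fun g : G => toHom g ξ

section UnitaryRep

variable {Ω : Type*} {G : Subgroup (Equiv.Perm Ω)}
variable {H : Type*} [NormedAddCommGroup H] [InnerProductSpace ℂ H]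

/-- The space `H_A` of vectors invariant under the pointwise stabilizer `G_A`. -/
def UnitaryRep.invariants (π : UnitaryRep G H) (A : Set Ω) : Submodule ℂ H where
  carrier := {ξ | ∀ g ∈ fixingSubgroup G A, π.toHom g ξ = ξ}
  zero_mem' := fun g _ => map_zero (π.toHom g)
  add_mem' := fun {x y} hx hy g hg => by rw [map_add, hx g hg, hy g hg]
  smul_mem' := fun c x hx g hg => by rw [map_smul, hx g hg]

theorem UnitaryRep.isClosed_invariants (π : UnitaryRep G H) (A : Set Ω) :
    IsClosed (π.invariants A : Set H) := by
  have h : (π.invariants A : Set H)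
      = ⋂ g ∈ fixingSubgroup G A, {ξ | π.toHom g ξ = ξ} := by
    ext ξ
    simp only [Set.mem_iInter]
    rfl
  rw [h]
  exact isClosed_biInter fun g _ => isClosed_eq (π.toHom g).continuous continuous_id

instance UnitaryRep.completeSpace_invariants [CompleteSpace H] (π : UnitaryRep G H)
    (A : Set Ω) : CompleteSpace (π.invariants A) :=
  (π.isClosed_invariants A).completeSpace_coe

/-- `p_A p_B = p_{A ∩ B}` for all finite `A, B ⊆ Ω`, where `p_A` is the orthogonal projection
onto `H_A`. -/
def UnitaryRep.IsDissociated [CompleteSpace H] (π : UnitaryRep G H) : Prop :=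
  ∀ A B : Set Ω, A.Finite → B.Finite →
    (π.invariants A).starProjection ∘L (π.invariants B).starProjection
      = (π.invariants (A ∩ B)).starProjection

end UnitaryRep

/-! ### Boolean p.m.p. actions -/

/-- A Boolean p.m.p. action on `(X, μ)`: a homomorphism from `G` to the group `Aut(X, μ)` of
measure-preserving automorphisms up to null sets, continuous for the weak topology. It is given
here by a choice of a representative of the image of each `g : G`. -/
structure BooleanPMPAction (G : Type*) [Group G] [TopologicalSpace G]
    (X : Type*) [MeasurableSpace X] (μ : Measure X) where
  toFun : G → X ≃ᵐ X
  measurePreserving : ∀ g, MeasurePreserving (toFun g) μ μ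
  map_mul : ∀ g h, (toFun (g * h) : X → X) =ᵐ[μ] toFun g ∘ toFun h
  weakly_continuous : ∀ Y : Set X, MeasurableSet Y → ∀ g₀ : G,
    Tendsto (fun g => μ ((toFun g '' Y) ∆ (toFun g₀ '' Y))) (𝓝 g₀) (𝓝 0)

section BooleanPMPAction

variable {Ω : Type*} {G : Subgroup (Equiv.Perm Ω)}
variable {X : Type*} [MeasurableSpace X] {μ : Measure X}

/-- The σ-algebra `F_A` of the measurable sets `Y` that are `G_A`-invariant in the sense that
`μ (g Y ∆ Y) = 0` for every `g ∈ G_A`. -/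
@[reducible] def BooleanPMPAction.invariantSets (α : BooleanPMPAction G X μ) (A : Set Ω) :
    MeasurableSpace X where
  MeasurableSet' Y := MeasurableSet Y ∧
    ∀ g ∈ fixingSubgroup G A, μ ((α.toFun g '' Y) ∆ Y) = 0
  measurableSet_empty := ⟨MeasurableSet.empty, fun g _ => by simp⟩
  measurableSet_compl := fun Y hY => ⟨hY.1.compl, fun g hg => by
    rw [Set.image_compl_eq (α.toFun g).bijective, compl_symmDiff_compl]
    exact hY.2 g hg⟩
  measurableSet_iUnion := fun Y hY => ⟨MeasurableSet.iUnion fun i => (hY i).1, fun g hg => by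
    rw [Set.image_iUnion]
    refine measure_mono_null ?_ (measure_iUnion_null fun i => (hY i).2 g hg)
    exact Set.iUnion_symmDiff_iUnion_subset⟩

/-- `F₁` and `F₃` are independent conditionally on `F₂`: `E[f | F₁] = E[f | F₂]` for every
square-integrable `F₃`-measurable function `f`. -/
def CondIndependent (μ : Measure X) (F₁ F₂ F₃ : MeasurableSpace X) : Prop :=
  ∀ f : X → ℂ, StronglyMeasurable[F₃] f → MemLp f 2 μ → μ[f|F₁] =ᵐ[μ] μ[f|F₂]

/-- For all finite `A, B ⊆ Ω`, the σ-algebras `F_A` and `F_B` are independent conditionally on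
`F_{A ∩ B}`. -/
def BooleanPMPAction.IsDissociated (α : BooleanPMPAction G X μ) : Prop :=
  ∀ A B : Set Ω, A.Finite → B.Finite →
    CondIndependent μ (α.invariantSets A) (α.invariantSets (A ∩ B)) (α.invariantSets B)

end BooleanPMPAction

/-- A permutation group is dissociated if all its unitary representations and all its Boolean
p.m.p. actions on standard probability spaces are dissociated. -/
def IsDissociated {Ω : Type w} (G : Subgroup (Equiv.Perm Ω)) : Prop :=
  (∀ (H : Type uH) [NormedAddCommGroup H] [InnerProductSpace ℂ H] [CompleteSpace H]
    (π : UnitaryRep G H), π.IsDissociated) ∧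
  (∀ (X : Type uX) [MeasurableSpace X] [StandardBorelSpace X] (μ : Measure X)
    [IsProbabilityMeasure μ] (α : BooleanPMPAction G X μ), α.IsDissociated)

/-- A topological group is Roelcke precompact if for every neighbourhood `U` of the identity there
is a finite set `F` such that `G = U F U`. -/
def IsRoelckePrecompact (G : Type*) [Group G] [TopologicalSpace G] : Prop :=
  ∀ U ∈ 𝓝 (1 : G), ∃ F : Set G, F.Finite ∧ U * F * U = Set.univ

/-! ### Structures -/

/-- The automorphism group of a first-order structure, as a permutation group of its domain. -/
def autGroup (L : FirstOrder.Language.{u, v}) (M : Type w) [L.Structure M] :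
    Subgroup (Equiv.Perm M) where
  carrier := {g | ∃ φ : M ≃[L] M, φ.toEquiv = g}
  one_mem' := ⟨FirstOrder.Language.Equiv.refl L M, rfl⟩
  mul_mem' := by
    rintro _ _ ⟨φ, rfl⟩ ⟨ψ, rfl⟩
    exact ⟨φ.comp ψ, rfl⟩
  inv_mem' := by
    rintro _ ⟨φ, rfl⟩
    exact ⟨φ.symm, rfl⟩

/-- The free amalgamation property of a structure `M` in a relational language. -/
def HasFreeAmalgamation (L : FirstOrder.Language.{u, v}) (M : Type w) [L.Structure M] : Prop :=
  ∀ (A B₁ B₂ : Bundled.{w} L.Structure) (f₁ : A ↪[L] B₁) (f₂ : A ↪[L] B₂),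
    A ∈ L.age M → B₁ ∈ L.age M → B₂ ∈ L.age M →
    ∃ (C : Bundled.{w} L.Structure) (g₁ : B₁ ↪[L] C) (g₂ : B₂ ↪[L] C),
      C ∈ L.age M ∧
      g₁.comp f₁ = g₂.comp f₂ ∧
      (∀ (b₁ : B₁) (b₂ : B₂), g₁ b₁ = g₂ b₂ → ∃ a : A, f₁ a = b₁ ∧ f₂ a = b₂) ∧
      (∀ (n : ℕ) (R : L.Relations n) (c : Fin n → C),
        FirstOrder.Language.Structure.RelMap R c →
          (∀ i, c i ∈ Set.range g₁) ∨ (∀ i, c i ∈ Set.range g₂))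

end Dissociation

namespace Dissociation

/-! ### Vectors fixed by a subgroup -/

section FixedVectors

variable {G : Type*} [Group G] {H : Type*} [NormedAddCommGroup H] [InnerProductSpace ℂ H]

/-! The heart is a Hilbert space criterion, `norm_sq_starProjection_fixedVectors`. Let `q` be the
projection of `ξ` to the vectors fixed by `S`. Then `ξ - q` is approximated by combinations of
displacements `T g ξ - ξ`, each involving finitely many `g ∈ S`. If some `h ∈ S` gives `T h ξ` the
same inner product `c` with all these translates and with `ξ`, then `T h ξ` is orthogonal to the
combination. Since `⟪q, T h ξ⟫ = ‖q‖ ^ 2`, letting the error tend to zero gives `‖q‖ ^ 2 = c`.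

Let `ξ` be fixed by the stabilizer of `A`. Then `T g ξ` depends only on `g` restricted to `A`. By
ultrahomogeneity, all pairs of translates of `A` in free position over `A ∩ B` are conjugate, so
they share one inner product `c`. Free amalgamation supplies, inside the stabilizer of `B` as well
as inside that of `A ∩ B`, a translate free from any finitely many given ones. The two projections
of `ξ` therefore have the same norm; as the fixed spaces are nested, they coincide
(`starProjection_fixedVectors_eq_inter`). Both dissociation statements follow, the one for Boolean
actions through the Koopman representation on L², where conditional expectations are projections to
fixed vectors.

The example is the countable random graph with edges in infinitely many colours: absence of an edge
gives free amalgamation, while the colour of the pair `0, g 0` is an invariant of double cosets of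
the stabilizer of `0` with infinitely many values. -/

/-- The space of vectors fixed by a subgroup under a (not necessarily continuous) unitary
representation. -/
def fixedVectors (T : G →* (H ≃ₗᵢ[ℂ] H)) (S : Subgroup G) : Submodule ℂ H where
  carrier := {ξ | ∀ g ∈ S, T g ξ = ξ}
  zero_mem' := fun g _ => map_zero (T g)
  add_mem' := fun {x y} hx hy g hg => by rw [map_add, hx g hg, hy g hg]
  smul_mem' := fun c x hx g hg => by rw [map_smul, hx g hg]

theorem mem_fixedVectors {T : G →* (H ≃ₗᵢ[ℂ] H)} {S : Subgroup G} {ξ : H} :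
    ξ ∈ fixedVectors T S ↔ ∀ g ∈ S, T g ξ = ξ := Iff.rfl

theorem fixedVectors_anti (T : G →* (H ≃ₗᵢ[ℂ] H)) {S S' : Subgroup G} (h : S ≤ S') :
    fixedVectors T S' ≤ fixedVectors T S := fun _ hξ g hg => hξ g (h hg)

theorem isClosed_fixedVectors (T : G →* (H ≃ₗᵢ[ℂ] H)) (S : Subgroup G) :
    IsClosed (fixedVectors T S : Set H) := by
  have h : (fixedVectors T S : Set H) = ⋂ g ∈ S, {ξ | T g ξ = ξ} := by
    ext ξ
    simp [mem_fixedVectors]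
  rw [h]
  exact isClosed_biInter fun g _ => isClosed_eq (T g).continuous continuous_id

instance completeSpace_fixedVectors [CompleteSpace H] (T : G →* (H ≃ₗᵢ[ℂ] H))
    (S : Subgroup G) : CompleteSpace (fixedVectors T S) :=
  (isClosed_fixedVectors T S).completeSpace_coe

theorem map_mul_vec (T : G →* (H ≃ₗᵢ[ℂ] H)) (g h : G) (ξ : H) :
    T (g * h) ξ = T g (T h ξ) := by rw [map_mul]; rfl

/-- The difference of a vector and its projection to the fixed vectors is a limit of combinations
of displacements of that vector. -/
theorem sub_starProjection_mem_closure_span [CompleteSpace H] (T : G →* (H ≃ₗᵢ[ℂ] H))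
    (S : Subgroup G) (ξ : H) :
    ξ - (fixedVectors T S).starProjection ξ ∈
      (Submodule.span ℂ {v | ∃ g ∈ S, v = T g ξ - ξ}).topologicalClosure := by
  set W := Submodule.span ℂ {v | ∃ g ∈ S, v = T g ξ - ξ} with hW
  set V := W.topologicalClosure with hV
  have : CompleteSpace V := W.isClosed_topologicalClosure.completeSpace_coe
  have hWV : W ≤ V := W.le_topologicalClosure
  have hgen : ∀ g ∈ S, T g ξ - ξ ∈ W := fun g hg => Submodule.subset_span ⟨g, hg, rfl⟩
  have hWinv : ∀ g ∈ S, ∀ v ∈ W, T g v ∈ W := by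
    intro g hg v hv
    induction hv using Submodule.span_induction with
    | mem x hx =>
      obtain ⟨k, hk, rfl⟩ := hx
      have : T g (T k ξ - ξ) = (T (g * k) ξ - ξ) - (T g ξ - ξ) := by
        rw [map_sub, map_mul_vec]; abel
      rw [this]
      exact W.sub_mem (hgen _ (S.mul_mem hg hk)) (hgen _ hg)
    | zero => rw [map_zero]; exact W.zero_mem
    | add x y _ _ hx hy => rw [map_add]; exact W.add_mem hx hy
    | smul c x _ hx => rw [map_smul]; exact W.smul_mem c hx
  have hq : V.starProjection ξ ∈ V := V.starProjection_apply_mem ξ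
  have horth : ξ - V.starProjection ξ ∈ Vᗮ := V.sub_starProjection_mem_orthogonal ξ
  have hVW : Vᗮ = Wᗮ := W.orthogonal_closure
  have hVinv : ∀ g ∈ S, ∀ v ∈ V, T g v ∈ V := by
    intro g hg v hv
    exact map_mem_closure (T g).continuous hv (hWinv g hg)
  -- Every displacement of this vector lies both in `V` and in its orthogonal complement.
  have hfix : ξ - V.starProjection ξ ∈ fixedVectors T S := by
    intro g hg
    rw [← sub_eq_zero, ← Submodule.mem_bot ℂ, ← V.inf_orthogonal_eq_bot]
    refine ⟨?_, ?_⟩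
    · have : T g (ξ - V.starProjection ξ) - (ξ - V.starProjection ξ)
          = (T g ξ - ξ) - (T g (V.starProjection ξ) - V.starProjection ξ) := by
        rw [map_sub]; abel
      rw [this]
      exact V.sub_mem (hWV (hgen g hg)) (V.sub_mem (hVinv g hg _ hq) hq)
    · refine Submodule.sub_mem _ ?_ horth
      intro v hv
      have h := horth _ (hVinv g⁻¹ (S.inv_mem hg) v hv)
      rw [← (T g).inner_map_map] at h
      have h2 : T g (T g⁻¹ v) = v := by simp
      rwa [h2] at h
  -- A fixed vector has the same inner product with all translates of `ξ`, so it is orthogonal to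
  -- displacements.
  have hperp : V ≤ (fixedVectors T S)ᗮ := by
    refine W.topologicalClosure_minimal ?_ (Submodule.isClosed_orthogonal _)
    rw [hW, Submodule.span_le]
    rintro _ ⟨g, hg, rfl⟩ η hη
    have h : inner ℂ η (T g ξ) = inner ℂ η ξ := by
      conv_lhs => rw [← hη g hg]
      exact (T g).inner_map_map η ξ
    rw [inner_sub_right, h, sub_self]
  have heq : (fixedVectors T S).starProjection ξ = ξ - V.starProjection ξ :=
    Submodule.eq_starProjection_of_mem_orthogonal hfix (by simpa using hperp hq)
  rw [heq, sub_sub_cancel]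
  exact hq

/-- If any finitely many translates of `ξ` have the same inner product `c` with some further
translate, then `c` is the squared norm of the projection of `ξ` to the fixed vectors. -/
theorem norm_sq_starProjection_fixedVectors [CompleteSpace H] (T : G →* (H ≃ₗᵢ[ℂ] H))
    (S : Subgroup G) (ξ : H) (c : ℂ)
    (hc : ∀ t : Set G, t.Finite → t ⊆ S → ∃ h ∈ S, ∀ g ∈ t, inner ℂ (T g ξ) (T h ξ) = c) :
    (‖(fixedVectors T S).starProjection ξ‖ ^ 2 : ℂ) = c := by
  set q := (fixedVectors T S).starProjection ξ with hq
  have hqmem : q ∈ fixedVectors T S := Submodule.starProjection_apply_mem _ ξ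
  have hqq : ∀ h ∈ S, inner ℂ q (T h ξ) = (‖q‖ ^ 2 : ℂ) := by
    intro h hh
    have h1 : inner ℂ q (T h ξ) = inner ℂ q ξ := by
      conv_lhs => rw [← hqmem h hh]
      exact (T h).inner_map_map q ξ
    have h2 : inner ℂ q (ξ - q) = 0 :=
      (fixedVectors T S).sub_starProjection_mem_orthogonal ξ q hqmem
    rw [inner_sub_right, sub_eq_zero] at h2
    rw [h1, h2, inner_self_eq_norm_sq_to_K]
    rfl
  have hspan : ∀ v ∈ Submodule.span ℂ {v | ∃ g ∈ S, v = T g ξ - ξ},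
      ∃ t : Set G, t.Finite ∧ t ⊆ S ∧
        ∀ h, (∀ g ∈ t, inner ℂ (T g ξ) (T h ξ) = c) → inner ℂ v (T h ξ) = 0 := by
    intro v hv
    induction hv using Submodule.span_induction with
    | mem x hx =>
      obtain ⟨g, hg, rfl⟩ := hx
      refine ⟨{1, g}, by simp, ?_, fun h hh => ?_⟩
      · rintro _ (rfl | rfl)
        exacts [S.one_mem, hg]
      · have h1 := hh 1 (by simp)
        rw [map_one] at h1
        rw [inner_sub_left, hh g (by simp)]
        exact sub_eq_zero.2 h1.symm
    | zero => exact ⟨∅, Set.finite_empty, Set.empty_subset _, fun _ _ => inner_zero_left _⟩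
    | add x y _ _ hx hy =>
      obtain ⟨s, hs, hsS, hs'⟩ := hx
      obtain ⟨t, ht, htS, ht'⟩ := hy
      refine ⟨s ∪ t, hs.union ht, Set.union_subset hsS htS, fun h hh => ?_⟩
      rw [inner_add_left, hs' h fun g hg => hh g (.inl hg), ht' h fun g hg => hh g (.inr hg),
        add_zero]
    | smul a x _ hx =>
      obtain ⟨s, hs, hsS, hs'⟩ := hx
      exact ⟨s, hs, hsS, fun h hh => by rw [inner_smul_left, hs' h hh, mul_zero]⟩
  have hbound : ∀ ε > 0, ‖(‖q‖ ^ 2 : ℂ) - c‖ ≤ ε * ‖ξ‖ := by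
    intro ε hε
    obtain ⟨v, hv, hvε⟩ := Metric.mem_closure_iff.1
      (sub_starProjection_mem_closure_span T S ξ) ε hε
    obtain ⟨t, ht, htS, ht'⟩ := hspan v hv
    -- Adding `1` also forces `⟪ξ, T h ξ⟫ = c`.
    obtain ⟨h, hh, hht⟩ := hc (insert 1 t) (ht.insert 1)
      (Set.insert_subset S.one_mem htS)
    have h1 : inner ℂ ξ (T h ξ) = c := by
      have := hht 1 (Set.mem_insert _ _)
      rwa [map_one] at this
    have h2 := ht' h fun g hg => hht g (Set.mem_insert_of_mem _ hg)
    have h3 : inner ℂ (ξ - q - v) (T h ξ) = c - (‖q‖ ^ 2 : ℂ) := by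
      rw [inner_sub_left, inner_sub_left, h1, h2, hqq h hh, sub_zero]
    rw [← norm_neg, neg_sub, ← h3]
    refine (norm_inner_le_norm _ _).trans ?_
    rw [(T h).norm_map]
    rw [dist_eq_norm] at hvε
    gcongr
  have hlim : Tendsto (fun ε : ℝ => ε * ‖ξ‖) (𝓝[>] 0) (𝓝 0) := by
    have : Tendsto (fun ε : ℝ => ε * ‖ξ‖) (𝓝 0) (𝓝 (0 * ‖ξ‖)) :=
      (continuous_id.mul continuous_const).tendsto 0
    rw [zero_mul] at this
    exact this.mono_left nhdsWithin_le_nhds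
  have h0 : ‖(‖q‖ ^ 2 : ℂ) - c‖ ≤ 0 :=
    ge_of_tendsto hlim (eventually_mem_nhdsWithin.mono hbound)
  exact sub_eq_zero.1 (norm_le_zero_iff.1 h0)

/-- Nested closed subspaces on which a vector has projections of the same norm. -/
theorem starProjection_eq_of_le_of_norm_eq {U V : Submodule ℂ H} [U.HasOrthogonalProjection]
    [V.HasOrthogonalProjection] (hUV : U ≤ V) {ξ : H}
    (h : ‖V.starProjection ξ‖ = ‖U.starProjection ξ‖) :
    V.starProjection ξ = U.starProjection ξ := by
  have h1 : U.starProjection (V.starProjection ξ) = U.starProjection ξ :=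
    congrArg (· ξ) (Submodule.starProjection_comp_starProjection_of_le hUV)
  -- Projecting it further to `U` does not shrink its norm.
  have h2 : V.starProjection ξ ∈ U := by
    rw [Submodule.mem_iff_norm_starProjection, h1, h]
  rw [← h1, Submodule.starProjection_eq_self_iff.2 h2]

end FixedVectors

/-! ### Free position in an ultrahomogeneous structure -/

section FreePosition

open FirstOrder FirstOrder.Language

variable {L : FirstOrder.Language.{u, v}} {M : Type w} [L.Structure M]

variable (L) in
/-- Every relation that holds inside `S ∪ T` holds inside `S` or inside `T`. -/
def InFreePosition (S T : Set M) : Prop :=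
  ∀ (n : ℕ) (R : L.Relations n) (x : Fin n → M), Structure.RelMap R x →
    (∀ i, x i ∈ S ∪ T) → (∀ i, x i ∈ S) ∨ (∀ i, x i ∈ T)

theorem relMap_comp_of_mem_autGroup {g : Equiv.Perm M} (hg : g ∈ autGroup L M) {n : ℕ}
    (R : L.Relations n) (x : Fin n → M) :
    Structure.RelMap R (g ∘ x) ↔ Structure.RelMap R x := by
  obtain ⟨φ, rfl⟩ := hg
  exact φ.map_rel R x

/-- A finite partial isomorphism of an ultrahomogeneous relational structure extends to an
automorphism. -/
theorem exists_mem_autGroup_eqOn [L.IsRelational] (hM : L.IsUltrahomogeneous M) {s : Set M}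
    (hs : s.Finite) (f : M → M) (hf : Set.InjOn f s)
    (hR : ∀ (n : ℕ) (R : L.Relations n) (x : Fin n → M), (∀ i, x i ∈ s) →
      (Structure.RelMap R (f ∘ x) ↔ Structure.RelMap R x)) :
    ∃ k ∈ autGroup L M, Set.EqOn k f s := by
  let S : L.Substructure M := Substructure.closure L s
  have hS : ∀ x : M, x ∈ S ↔ x ∈ s := Substructure.mem_closure_iff_of_isRelational L s
  let e : S ↪[L] M :=
    { toFun := fun x => f x
      inj' := fun x y hxy => Subtype.ext (hf ((hS _).1 x.2) ((hS _).1 y.2) hxy)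
      map_fun' := fun {n} F => isEmptyElim F
      map_rel' := fun {n} R x => hR n R (fun i => x i) fun i => (hS _).1 (x i).2 }
  obtain ⟨φ, hφ⟩ := hM S (Substructure.fg_closure hs) e
  refine ⟨φ.toEquiv, ⟨φ, rfl⟩, fun x hx => ?_⟩
  have := congrArg (fun u : S ↪[L] M => u ⟨x, (hS x).2 hx⟩) hφ
  exact this.symm

/-- An embedding of a finite subset of an ultrahomogeneous relational structure, regarded as a
substructure, extends to an automorphism. -/
theorem exists_mem_autGroup_extend_embedding [L.IsRelational] (hM : L.IsUltrahomogeneous M)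
    {s : Set M} (hs : s.Finite) (f : Substructure.closure L s ↪[L] M) :
    ∃ k ∈ autGroup L M, ∀ x : Substructure.closure L s, k x = f x := by
  obtain ⟨φ, hφ⟩ := hM _ (Substructure.fg_closure hs) f
  exact ⟨φ.toEquiv, ⟨φ, rfl⟩, fun x => (congrArg (fun u : _ ↪[L] M => u x) hφ).symm⟩

/-- With free amalgamation, a finite set can be moved over a subset `B` to a position that is free
from a given finite set over `B`. -/
theorem exists_image_inFreePosition [L.IsRelational] (hM : L.IsUltrahomogeneous M)
    (hfree : HasFreeAmalgamation L M) {B D F : Set M} (hD : D.Finite) (hF : F.Finite)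
    (hBD : B ⊆ D) (hBF : B ⊆ F) :
    ∃ h ∈ autGroup L M, (∀ b ∈ B, h b = b) ∧ (h '' D) ∩ F ⊆ B ∧
      InFreePosition L (h '' D) F := by
  have hB : B.Finite := hD.subset hBD
  have key : ∀ s : Set M, ∀ x : M, x ∈ Substructure.closure L s ↔ x ∈ s :=
    Substructure.mem_closure_iff_of_isRelational L
  let f₁ : Substructure.closure L B ↪[L] Substructure.closure L D :=
    Substructure.inclusion (Substructure.closure_mono hBD)
  let f₂ : Substructure.closure L B ↪[L] Substructure.closure L F :=
    Substructure.inclusion (Substructure.closure_mono hBF)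
  obtain ⟨C, g₁, g₂, ⟨-, ⟨e⟩⟩, hcomm, hint, hrel⟩ :=
    hfree ⟨Substructure.closure L B, inferInstance⟩ ⟨Substructure.closure L D, inferInstance⟩
      ⟨Substructure.closure L F, inferInstance⟩ f₁ f₂
      (age.fg_substructure (Substructure.fg_closure hB))
      (age.fg_substructure (Substructure.fg_closure hD))
      (age.fg_substructure (Substructure.fg_closure hF))
  -- Embed the amalgam by `e`. The copies of `F` and `D` there are `k '' F` and `h '' D`; pulling
  -- back by `k` returns `F` to its place, so `k⁻¹ * h` is the required motion.
  obtain ⟨k, hk, hkF⟩ := exists_mem_autGroup_extend_embedding hM hF (e.comp g₂)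
  obtain ⟨h, hh, hhD⟩ := exists_mem_autGroup_extend_embedding hM hD (e.comp g₁)
  have hkh : ∀ x, (k⁻¹ * h) x = k.symm (h x) := fun _ => rfl
  have hmem₁ : ∀ x ∈ (k⁻¹ * h : Equiv.Perm M) '' D, ∃ d : Substructure.closure L D,
      k x = e (g₁ d) ∧ h d = k x := by
    rintro _ ⟨d, hd, rfl⟩
    refine ⟨⟨d, (key D d).2 hd⟩, ?_, ?_⟩
    · rw [hkh, Equiv.apply_symm_apply]
      exact hhD ⟨d, (key D d).2 hd⟩
    · rw [hkh, Equiv.apply_symm_apply]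
  have hmem₂ : ∀ x ∈ F, ∃ d : Substructure.closure L F, k x = e (g₂ d) ∧ (d : M) = x := fun x hx =>
    ⟨⟨x, (key F x).2 hx⟩, hkF ⟨x, (key F x).2 hx⟩, rfl⟩
  have hback₁ : ∀ x, k x ∈ Set.range (e ∘ g₁) → x ∈ (k⁻¹ * h : Equiv.Perm M) '' D := by
    rintro x ⟨d, hd⟩
    refine ⟨d, (key D d).1 d.2, ?_⟩
    rw [hkh, Equiv.symm_apply_eq, ← hd]
    exact hhD d
  have hback₂ : ∀ x, k x ∈ Set.range (e ∘ g₂) → x ∈ F := by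
    rintro x ⟨d, hd⟩
    have : k d = k x := (hkF d).trans hd
    rw [← k.injective this]
    exact (key F d).1 d.2
  refine ⟨k⁻¹ * h, (autGroup L M).mul_mem ((autGroup L M).inv_mem hk) hh, fun b hb => ?_, ?_, ?_⟩
  · rw [hkh, Equiv.symm_apply_eq]
    have h1 := hhD ⟨b, (key D b).2 (hBD hb)⟩
    have h2 := hkF ⟨b, (key F b).2 (hBF hb)⟩
    have h3 := congrArg (fun u : Substructure.closure L B ↪[L] C => e (u ⟨b, (key B b).2 hb⟩)) hcomm
    exact h1.trans (h3.trans h2.symm)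
  · rintro x ⟨hx₁, hx₂⟩
    obtain ⟨d, hd, -⟩ := hmem₁ x hx₁
    obtain ⟨y, hy, rfl⟩ := hmem₂ x hx₂
    obtain ⟨a, -, ha⟩ := hint d y (e.injective (hd.symm.trans hy))
    have : (a : M) = y := congrArg Subtype.val ha
    rw [← this]
    exact (key B a).1 a.2
  · intro n R x hRx hx
    have hy : ∀ i, ∃ c : C, e c = k (x i) := by
      intro i
      rcases hx i with hi | hi
      · obtain ⟨d, hd, -⟩ := hmem₁ _ hi
        exact ⟨g₁ d, hd.symm⟩
      · obtain ⟨d, hd, -⟩ := hmem₂ _ hi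
        exact ⟨g₂ d, hd.symm⟩
    choose y hy using hy
    have hRy : Structure.RelMap R y := by
      rw [← e.map_rel, show (e ∘ y) = k ∘ x from funext hy]
      exact (relMap_comp_of_mem_autGroup hk R x).2 hRx
    refine (hrel n R y hRy).imp (fun h' i => hback₁ _ ?_) (fun h' i => hback₂ _ ?_)
    all_goals
      obtain ⟨d, hd⟩ := h' i
      exact ⟨d, by rw [Function.comp_apply, hd, hy]⟩

/-- Two pairs of translates of `A` that are in free position over `C` are conjugate. -/
theorem exists_mem_autGroup_of_inFreePosition [L.IsRelational] (hM : L.IsUltrahomogeneous M)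
    {A C : Set M} (hA : A.Finite) {g h g' h' : Equiv.Perm M}
    (hg : g ∈ autGroup L M) (hh : h ∈ autGroup L M) (hg' : g' ∈ autGroup L M)
    (hh' : h' ∈ autGroup L M) (hgC : ∀ c ∈ C, g c = c) (hhC : ∀ c ∈ C, h c = c)
    (hgC' : ∀ c ∈ C, g' c = c) (hhC' : ∀ c ∈ C, h' c = c)
    (hint : (g '' A) ∩ (h '' A) ⊆ C) (hint' : (g' '' A) ∩ (h' '' A) ⊆ C)
    (hfree : InFreePosition L (g '' A) (h '' A))
    (hfree' : InFreePosition L (g' '' A) (h' '' A)) :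
    ∃ k ∈ autGroup L M, ∀ a ∈ A, k (g a) = g' a ∧ k (h a) = h' a := by
  classical
  -- The two prescriptions agree on the overlap, which lies in `C`, where all four automorphisms are
  -- the identity.
  let f : M → M := fun x => if x ∈ g '' A then g' (g.symm x) else h' (h.symm x)
  have hfg : ∀ a ∈ A, f (g a) = g' a := fun a ha => by
    simp only [f, if_pos (Set.mem_image_of_mem g ha), Equiv.symm_apply_apply]
  have hfh : ∀ a ∈ A, f (h a) = h' a := by
    intro a ha
    by_cases hx : h a ∈ g '' A
    · have hC : h a ∈ C := hint ⟨hx, Set.mem_image_of_mem h ha⟩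
      have h1 : g.symm (h a) = h a := by rw [Equiv.symm_apply_eq, hgC _ hC]
      have h2 : h a = a := h.injective (hhC _ hC)
      simp only [f, if_pos hx, h1]
      rw [h2] at hC ⊢
      rw [hgC' _ hC, hhC' _ hC]
    · simp only [f, if_neg hx, Equiv.symm_apply_apply]
  have hRg : ∀ (n : ℕ) (R : L.Relations n) (x : Fin n → M), (∀ i, x i ∈ g '' A) →
      (Structure.RelMap R (f ∘ x) ↔ Structure.RelMap R x) := by
    intro n R x hx
    choose a ha hax using hx
    obtain rfl : g ∘ a = x := funext hax
    rw [show f ∘ g ∘ a = g' ∘ a from funext fun i => hfg _ (ha i),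
      relMap_comp_of_mem_autGroup hg, relMap_comp_of_mem_autGroup hg']
  have hRh : ∀ (n : ℕ) (R : L.Relations n) (x : Fin n → M), (∀ i, x i ∈ h '' A) →
      (Structure.RelMap R (f ∘ x) ↔ Structure.RelMap R x) := by
    intro n R x hx
    choose a ha hax using hx
    obtain rfl : h ∘ a = x := funext hax
    rw [show f ∘ h ∘ a = h' ∘ a from funext fun i => hfh _ (ha i),
      relMap_comp_of_mem_autGroup hh, relMap_comp_of_mem_autGroup hh']
  -- The target pair has no coincidences outside `C`; this gives injectivity of `f` and lets
  -- relations be pulled back.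
  have hcross : ∀ a ∈ A, ∀ b ∈ A, g' a = h' b → g a = h b := by
    intro a ha b hb hab
    have hC : g' a ∈ C := hint' ⟨Set.mem_image_of_mem _ ha, hab ▸ Set.mem_image_of_mem _ hb⟩
    have h1 : g' a = a := g'.injective (hgC' _ hC)
    have h2 : h' b = b := h'.injective (hhC' _ (hab ▸ hC))
    have h3 : a = b := by rw [← h1, hab, h2]
    rw [h1] at hC
    rw [← h3, hgC _ hC, hhC _ hC]
  have hinj : Set.InjOn f (g '' A ∪ h '' A) := by
    rintro _ (⟨a, ha, rfl⟩ | ⟨a, ha, rfl⟩) _ (⟨b, hb, rfl⟩ | ⟨b, hb, rfl⟩) hab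
    · rw [hfg a ha, hfg b hb] at hab
      rw [g'.injective hab]
    · rw [hfg a ha, hfh b hb] at hab
      exact hcross a ha b hb hab
    · rw [hfh a ha, hfg b hb] at hab
      exact (hcross b hb a ha hab.symm).symm
    · rw [hfh a ha, hfh b hb] at hab
      rw [h'.injective hab]
  have hmapg : ∀ x ∈ g '' A ∪ h '' A, f x ∈ g' '' A → x ∈ g '' A := by
    rintro _ (hx | ⟨a, ha, rfl⟩)
    · exact fun _ => hx
    · rw [hfh a ha]
      rintro ⟨b, hb, hab⟩
      exact ⟨b, hb, hcross b hb a ha hab⟩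
  have hmaph : ∀ x ∈ g '' A ∪ h '' A, f x ∈ h' '' A → x ∈ h '' A := by
    rintro _ (⟨a, ha, rfl⟩ | hx)
    · rw [hfg a ha]
      rintro ⟨b, hb, hab⟩
      exact ⟨b, hb, (hcross a ha b hb hab.symm).symm⟩
    · exact fun _ => hx
  have hmap : ∀ x ∈ g '' A ∪ h '' A, f x ∈ g' '' A ∪ h' '' A := by
    rintro _ (⟨a, ha, rfl⟩ | ⟨a, ha, rfl⟩)
    · exact .inl ⟨a, ha, (hfg a ha).symm⟩
    · exact .inr ⟨a, ha, (hfh a ha).symm⟩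
  obtain ⟨k, hk, hkf⟩ := exists_mem_autGroup_eqOn hM ((hA.image g).union (hA.image h)) f hinj
    (fun n R x hx => by
      refine ⟨fun hR => ?_, fun hR => ?_⟩
      · rcases hfree' n R _ hR fun i => hmap _ (hx i) with h1 | h1
        · exact (hRg n R x fun i => hmapg _ (hx i) (h1 i)).1 hR
        · exact (hRh n R x fun i => hmaph _ (hx i) (h1 i)).1 hR
      · rcases hfree n R x hR hx with h1 | h1
        · exact (hRg n R x h1).2 hR
        · exact (hRh n R x h1).2 hR)
  exact ⟨k, hk, fun a ha => ⟨(hkf (.inl ⟨a, ha, rfl⟩)).trans (hfg a ha),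
    (hkf (.inr ⟨a, ha, rfl⟩)).trans (hfh a ha)⟩⟩

end FreePosition

/-! ### Dissociation for unitary representations -/

section Unitary

open FirstOrder FirstOrder.Language

variable {L : FirstOrder.Language.{u, v}} {M : Type w} [L.Structure M]
variable {H : Type*} [NormedAddCommGroup H] [InnerProductSpace ℂ H]

/-- The quotient `h⁻¹ * g` fixes `A` pointwise, so inner products of translates of `ξ` are
controlled by the positions of translates of `A`. -/
theorem apply_eq_of_eqOn {Ω : Type*} {G : Subgroup (Equiv.Perm Ω)} (T : G →* (H ≃ₗᵢ[ℂ] H))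
    {A : Set Ω} {ξ : H} (hξ : ξ ∈ fixedVectors T (fixingSubgroup G A)) {g h : G}
    (hgh : ∀ a ∈ A, (g : Equiv.Perm Ω) a = (h : Equiv.Perm Ω) a) : T g ξ = T h ξ := by
  have hmem : h⁻¹ * g ∈ fixingSubgroup G A := by
    rw [mem_fixingSubgroup_iff]
    intro a ha
    rw [mul_smul, inv_smul_eq_iff]
    exact hgh a ha
  have h1 : T h (T (h⁻¹ * g) ξ) = T g ξ := by rw [← map_mul_vec, mul_inv_cancel_left]
  rw [← h1, hξ _ hmem]

/-- Over any finite `B`, the set `A` has a translate that is in free position over `A ∩ B` with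
respect to each of finitely many given translates. -/
theorem exists_translate_inFreePosition [L.IsRelational] (hM : L.IsUltrahomogeneous M)
    (hfree : HasFreeAmalgamation L M) {A B : Set M} (hA : A.Finite) (hB : B.Finite)
    {t : Set (autGroup L M)} (ht : t.Finite) (htB : t ⊆ fixingSubgroup (autGroup L M) B) :
    ∃ h ∈ fixingSubgroup (autGroup L M) B, ∀ g ∈ t,
      ((g : Equiv.Perm M) '' A) ∩ ((h : Equiv.Perm M) '' A) ⊆ A ∩ B ∧
        InFreePosition L ((g : Equiv.Perm M) '' A) ((h : Equiv.Perm M) '' A) := by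
  obtain ⟨h, hh, hhB, hint, hpos⟩ := exists_image_inFreePosition hM hfree
    (B := B) (D := A ∪ B) (F := B ∪ ⋃ g ∈ t, (g : Equiv.Perm M) '' A) (hA.union hB)
    (hB.union (ht.biUnion fun g _ => hA.image _)) Set.subset_union_right Set.subset_union_left
  refine ⟨⟨h, hh⟩, (mem_fixingSubgroup_iff _).2 hhB, fun g hg => ?_⟩
  have hgB : ∀ b ∈ B, (g : Equiv.Perm M) b = b := (mem_fixingSubgroup_iff _).1 (htB hg)
  have hgF : ∀ x ∈ (g : Equiv.Perm M) '' A, x ∈ B ∪ ⋃ g ∈ t, (g : Equiv.Perm M) '' A :=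
    fun x hx => .inr (Set.mem_biUnion hg hx)
  have hhD : ∀ x ∈ h '' A, x ∈ h '' (A ∪ B) := fun x hx => Set.image_mono Set.subset_union_left hx
  have inter_of_fix : ∀ k : Equiv.Perm M, (∀ b ∈ B, k b = b) → ∀ x ∈ k '' A, x ∈ B →
      x ∈ A ∩ B := by
    rintro k hk _ ⟨a, ha, rfl⟩ hx
    have : k a = a := k.injective (hk _ hx)
    exact ⟨this.symm ▸ ha, hx⟩
  have mem_of_inter : ∀ k : Equiv.Perm M, (∀ b ∈ B, k b = b) → ∀ x ∈ A ∩ B, x ∈ k '' A :=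
    fun k hk x hx => ⟨x, hx.1, hk x hx.2⟩
  refine ⟨fun x hx => inter_of_fix g hgB x hx.1 (hint ⟨hhD x hx.2, hgF x hx.1⟩), ?_⟩
  intro n R x hR hx
  rcases hpos n R x hR fun i => (hx i).symm.imp (hhD _) (hgF _) with hx' | hx'
  -- Freeness was obtained for the larger sets. An entry of `g '' A` also lying in `h '' (A ∪ B)` is
  -- in `A ∩ B`, hence in `h '' A`; the other case is symmetric.
  · refine .inr fun i => (hx i).elim (fun hi => ?_) id
    exact mem_of_inter h hhB _ (inter_of_fix g hgB _ hi (hint ⟨hx' i, hgF _ hi⟩))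
  · refine .inl fun i => (hx i).elim id fun hi => ?_
    exact mem_of_inter g hgB _ (inter_of_fix h hhB _ hi (hint ⟨hhD _ hi, hx' i⟩))

/-- A vector fixed by the pointwise stabilizer of `A` has the same projection to the vectors fixed
by the stabilizer of `B` as to those fixed by the stabilizer of `A ∩ B`. -/
theorem starProjection_fixedVectors_eq_inter [CompleteSpace H] [L.IsRelational]
    (hM : L.IsUltrahomogeneous M) (hfree : HasFreeAmalgamation L M)
    (T : autGroup L M →* (H ≃ₗᵢ[ℂ] H)) {A B : Set M} (hA : A.Finite) (hB : B.Finite) {ξ : H}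
    (hξ : ξ ∈ fixedVectors T (fixingSubgroup (autGroup L M) A)) :
    (fixedVectors T (fixingSubgroup (autGroup L M) B)).starProjection ξ =
      (fixedVectors T (fixingSubgroup (autGroup L M) (A ∩ B))).starProjection ξ := by
  have hanti : fixingSubgroup (autGroup L M) B ≤ fixingSubgroup (autGroup L M) (A ∩ B) :=
    fixingSubgroup_antitone _ _ Set.inter_subset_right
  -- The pair `1, h₀` is the reference free pair whose inner product is the common constant.
  obtain ⟨h₀, hh₀, hpos₀⟩ := exists_translate_inFreePosition hM hfree hA hB
    (Set.finite_singleton 1) (Set.singleton_subset_iff.2 (one_mem _))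
  obtain ⟨hint₀, hfree₀⟩ := hpos₀ 1 rfl
  have hconst : ∀ g ∈ fixingSubgroup (autGroup L M) (A ∩ B),
      ∀ h ∈ fixingSubgroup (autGroup L M) (A ∩ B),
      ((g : Equiv.Perm M) '' A) ∩ ((h : Equiv.Perm M) '' A) ⊆ A ∩ B →
      InFreePosition L ((g : Equiv.Perm M) '' A) ((h : Equiv.Perm M) '' A) →
      inner ℂ (T g ξ) (T h ξ) = inner ℂ ξ (T h₀ ξ) := by
    intro g hg h hh hint hpos
    obtain ⟨k, hk, hkA⟩ := exists_mem_autGroup_of_inFreePosition hM hA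
      (one_mem (autGroup L M)) h₀.2 g.2 h.2 (C := A ∩ B)
      (fun _ _ => rfl) ((mem_fixingSubgroup_iff _).1 (hanti hh₀))
      ((mem_fixingSubgroup_iff _).1 hg) ((mem_fixingSubgroup_iff _).1 hh)
      hint₀ hint hfree₀ hpos
    have h1 : T ⟨k, hk⟩ ξ = T g ξ := apply_eq_of_eqOn T hξ fun a ha => (hkA a ha).1
    have h2 : T ⟨k, hk⟩ (T h₀ ξ) = T h ξ := by
      rw [← map_mul_vec]
      exact apply_eq_of_eqOn T hξ fun a ha => (hkA a ha).2
    rw [← h1, ← h2, LinearIsometryEquiv.inner_map_map]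
  -- Needed for `B' = B` and `B' = A ∩ B`: only the intersection with `A` enters the constant.
  have hnorm : ∀ B' : Set M, B'.Finite → A ∩ B' = A ∩ B →
      (‖(fixedVectors T (fixingSubgroup (autGroup L M) B')).starProjection ξ‖ ^ 2 : ℂ) =
        inner ℂ ξ (T h₀ ξ) := by
    intro B' hB' hAB
    have hanti' : fixingSubgroup (autGroup L M) B' ≤ fixingSubgroup (autGroup L M) (A ∩ B) :=
      hAB ▸ fixingSubgroup_antitone _ _ Set.inter_subset_right
    refine norm_sq_starProjection_fixedVectors T _ ξ _ fun t ht htS => ?_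
    obtain ⟨h, hh, hpos⟩ := exists_translate_inFreePosition hM hfree hA hB' ht htS
    rw [hAB] at hpos
    exact ⟨h, hh, fun g hg =>
      hconst g (hanti' (htS hg)) h (hanti' hh) (hpos g hg).1 (hpos g hg).2⟩
  refine starProjection_eq_of_le_of_norm_eq (fixedVectors_anti T hanti) ?_
  have h := (hnorm B hB rfl).trans
    (hnorm (A ∩ B) (hA.inter_of_left B) (by rw [← Set.inter_assoc, Set.inter_self])).symm
  exact (pow_left_inj₀ (norm_nonneg _) (norm_nonneg _) two_ne_zero).1 (by exact_mod_cast h)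

theorem UnitaryRep.isDissociated_of_hasFreeAmalgamation [CompleteSpace H] [L.IsRelational]
    (hM : L.IsUltrahomogeneous M) (hfree : HasFreeAmalgamation L M)
    (π : UnitaryRep (autGroup L M) H) : π.IsDissociated := by
  intro A B hA hB
  ext ξ
  have h1 : (π.invariants A).starProjection ((π.invariants B).starProjection ξ) =
      (π.invariants (B ∩ A)).starProjection ((π.invariants B).starProjection ξ) :=
    starProjection_fixedVectors_eq_inter hM hfree π.toHom hB hA
      (Submodule.starProjection_apply_mem _ ξ)
  have h2 : π.invariants (B ∩ A) ≤ π.invariants B :=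
    fixedVectors_anti π.toHom (fixingSubgroup_antitone _ _ Set.inter_subset_left)
  have h3 : (π.invariants (B ∩ A)).starProjection ((π.invariants B).starProjection ξ) =
      (π.invariants (B ∩ A)).starProjection ξ :=
    congrArg (· ξ) (Submodule.starProjection_comp_starProjection_of_le h2)
  rw [ContinuousLinearMap.comp_apply, h1, h3]
  simp only [Set.inter_comm B A]

end Unitary

/-! ### Dissociation for Boolean actions -/

section Koopman

variable {G : Type*} [Group G] [TopologicalSpace G]
variable {X : Type*} [MeasurableSpace X] {μ : Measure X}

namespace BooleanPMPAction

/-- An injective map that is almost everywhere idempotent is almost everywhere the identity. -/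
theorem map_one_ae (α : BooleanPMPAction G X μ) : (α.toFun 1 : X → X) =ᵐ[μ] id := by
  have h := α.map_mul 1 1
  rw [mul_one] at h
  filter_upwards [h] with x hx
  exact ((α.toFun 1).injective hx).symm

theorem map_inv_ae (α : BooleanPMPAction G X μ) (g : G) :
    (α.toFun g⁻¹ : X → X) =ᵐ[μ] (α.toFun g).symm := by
  have h := α.map_mul g g⁻¹
  rw [mul_inv_cancel] at h
  filter_upwards [h, α.map_one_ae] with x hx h1
  rw [MeasurableEquiv.eq_symm_apply]
  exact hx.symm.trans h1

/-- Translation of a square-integrable function. -/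
noncomputable def translate (α : BooleanPMPAction G X μ) (g : G) :
    Lp ℂ 2 μ →ₗᵢ[ℂ] Lp ℂ 2 μ :=
  Lp.compMeasurePreservingₗᵢ ℂ (α.toFun g⁻¹) (α.measurePreserving g⁻¹)

theorem coeFn_translate (α : BooleanPMPAction G X μ) (g : G) (f : Lp ℂ 2 μ) :
    α.translate g f =ᵐ[μ] f ∘ α.toFun g⁻¹ :=
  Lp.coeFn_compMeasurePreserving f (α.measurePreserving g⁻¹)

theorem translate_one (α : BooleanPMPAction G X μ) (f : Lp ℂ 2 μ) : α.translate 1 f = f := by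
  refine Lp.ext ((α.coeFn_translate 1 f).trans ?_)
  rw [inv_one]
  filter_upwards [α.map_one_ae] with x hx
  rw [Function.comp_apply, hx, id]

theorem translate_mul (α : BooleanPMPAction G X μ) (g h : G) (f : Lp ℂ 2 μ) :
    α.translate (g * h) f = α.translate g (α.translate h f) := by
  refine Lp.ext ((α.coeFn_translate (g * h) f).trans ?_)
  have h1 := (α.measurePreserving g⁻¹).quasiMeasurePreserving.ae_eq_comp (α.coeFn_translate h f)
  rw [mul_inv_rev]
  filter_upwards [α.map_mul h⁻¹ g⁻¹, α.coeFn_translate g (α.translate h f), h1] with x hx h2 h3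
  rw [h2, h3, Function.comp_apply, hx]
  rfl

/-- The Koopman representation of a Boolean action. -/
noncomputable def koopman (α : BooleanPMPAction G X μ) :
    G →* (Lp ℂ 2 μ ≃ₗᵢ[ℂ] Lp ℂ 2 μ) where
  toFun g :=
    { toLinearEquiv := LinearEquiv.ofLinearMap (α.translate g).toLinearMap
        (α.translate g⁻¹).toLinearMap
        (LinearMap.ext fun f => by
          change α.translate g (α.translate g⁻¹ f) = f
          rw [← translate_mul, mul_inv_cancel, translate_one])
        (LinearMap.ext fun f => by
          change α.translate g⁻¹ (α.translate g f) = f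
          rw [← translate_mul, inv_mul_cancel, translate_one])
      norm_map' := (α.translate g).norm_map }
  map_one' := LinearIsometryEquiv.ext α.translate_one
  map_mul' g h := LinearIsometryEquiv.ext (α.translate_mul g h)

theorem coeFn_koopman (α : BooleanPMPAction G X μ) (g : G) (f : Lp ℂ 2 μ) :
    α.koopman g f =ᵐ[μ] f ∘ (α.toFun g).symm := by
  refine (α.coeFn_translate g f).trans ?_
  filter_upwards [α.map_inv_ae g] with x hx
  rw [Function.comp_apply, hx, Function.comp_apply]

end BooleanPMPAction

end Koopman

/-! ### Invariant σ-algebras and fixed vectors of the Koopman representation -/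

section Boolean

variable {Ω : Type*} {G : Subgroup (Equiv.Perm Ω)}
variable {X : Type*} [mX : MeasurableSpace X] {μ : Measure X}

namespace BooleanPMPAction

theorem invariantSets_le (α : BooleanPMPAction G X μ) (A : Set Ω) : α.invariantSets A ≤ mX :=
  fun _ hY => hY.1

/-- Invariance of the preimages of a countable basis of `ℂ` discards only countably many null sets,
and basic open sets separate values. -/
theorem measurable_invariantSets_iff {α : BooleanPMPAction G X μ} {A : Set Ω} {f : X → ℂ} :
    Measurable[α.invariantSets A] f ↔
      Measurable f ∧ ∀ g ∈ fixingSubgroup G A, f ∘ (α.toFun g).symm =ᵐ[μ] f := by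
  have himage : ∀ (g : G) (s : Set ℂ),
      α.toFun g '' (f ⁻¹' s) = (f ∘ (α.toFun g).symm) ⁻¹' s := by
    intro g s
    rw [Set.preimage_comp]
    exact (α.toFun g).toEquiv.image_eq_preimage_symm _
  constructor
  · intro hf
    refine ⟨hf.mono (α.invariantSets_le A) le_rfl, fun g hg => ?_⟩
    obtain ⟨b, hb, -, hbasis⟩ := TopologicalSpace.exists_countable_basis ℂ
    have hnull : ∀ᵐ x ∂μ, ∀ s ∈ b, ((f ∘ (α.toFun g).symm) x ∈ s ↔ f x ∈ s) := by
      rw [ae_ball_iff hb]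
      intro s hs
      have h := (hf (hbasis.isOpen hs).measurableSet).2 g hg
      rw [himage] at h
      exact (measure_symmDiff_eq_zero_iff.1 h).mem_iff
    filter_upwards [hnull] with x hx
    exact hbasis.eq_iff.2 hx
  · rintro ⟨hf, hinv⟩ s hs
    refine ⟨hf hs, fun g hg => ?_⟩
    rw [himage, measure_symmDiff_eq_zero_iff]
    filter_upwards [hinv g hg] with x hx
    exact congrArg (· ∈ s) hx

/-- This turns conditional expectation on L² into the projection to fixed vectors. Invariance is
only required up to null sets, so any measurable representative of a fixed vector is measurable for
the invariant σ-algebra. -/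
theorem lpMeas_invariantSets (α : BooleanPMPAction G X μ) (A : Set Ω) :
    lpMeas ℂ ℂ (α.invariantSets A) 2 μ = fixedVectors α.koopman (fixingSubgroup G A) := by
  ext f
  rw [mem_lpMeas_iff_aestronglyMeasurable, mem_fixedVectors]
  have hcomp : ∀ (g : G) {u v : X → ℂ}, u =ᵐ[μ] v →
      u ∘ (α.toFun g).symm =ᵐ[μ] v ∘ (α.toFun g).symm := fun g _ _ huv =>
    ((α.measurePreserving g).symm _).quasiMeasurePreserving.ae_eq_comp huv
  constructor
  · rintro ⟨f', hf', hff'⟩ g hg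
    refine Lp.ext ((α.coeFn_koopman g f).trans ?_)
    exact (hcomp g hff').trans
      (((measurable_invariantSets_iff.1 hf'.measurable).2 g hg).trans hff'.symm)
  · intro hf
    have hsm := Lp.stronglyMeasurable f
    refine ⟨f, (measurable_invariantSets_iff.2 ⟨hsm.measurable, fun g hg => ?_⟩).stronglyMeasurable,
      ae_eq_rfl⟩
    have h := (α.coeFn_koopman g f).symm
    rwa [hf g hg] at h

theorem condExp_ae_eq_starProjection [IsFiniteMeasure μ] (α : BooleanPMPAction G X μ)
    (A : Set Ω) {f : X → ℂ} (hf : MemLp f 2 μ) :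
    μ[f|α.invariantSets A] =ᵐ[μ]
      (fixedVectors α.koopman (fixingSubgroup G A)).starProjection (hf.toLp f) := by
  refine (hf.condExpL2_ae_eq_condExp (𝕜 := ℂ) (α.invariantSets_le A)).symm.trans ?_
  have : Fact (α.invariantSets A ≤ mX) := ⟨α.invariantSets_le A⟩
  have h : (condExpL2 ℂ ℂ (α.invariantSets_le A) (hf.toLp f) : Lp ℂ 2 μ) =
      (fixedVectors α.koopman (fixingSubgroup G A)).starProjection (hf.toLp f) := by
    change (lpMeas ℂ ℂ (α.invariantSets A) 2 μ).starProjection (hf.toLp f) = _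
    simp only [α.lpMeas_invariantSets A]
  rw [h]

theorem isDissociated_of_hasFreeAmalgamation {L : FirstOrder.Language.{u, v}} {M : Type w}
    [L.Structure M] [L.IsRelational] [IsFiniteMeasure μ] (hM : L.IsUltrahomogeneous M)
    (hfree : HasFreeAmalgamation L M) (α : BooleanPMPAction (autGroup L M) X μ) :
    α.IsDissociated := by
  intro A B hA hB f hf hf2
  have hmem : hf2.toLp f ∈ fixedVectors α.koopman (fixingSubgroup (autGroup L M) B) := by
    rw [← lpMeas_invariantSets, mem_lpMeas_iff_aestronglyMeasurable]
    exact ⟨f, hf, hf2.coeFn_toLp⟩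
  have h := starProjection_fixedVectors_eq_inter hM hfree α.koopman hB hA hmem
  rw [Set.inter_comm] at h
  refine (α.condExp_ae_eq_starProjection A hf2).trans ?_
  rw [h]
  exact (α.condExp_ae_eq_starProjection (A ∩ B) hf2).symm

end BooleanPMPAction

end Boolean

/-! ### The random edge-colouring with infinitely many colours -/

section EdgeColouring

open FirstOrder FirstOrder.Language

/-- The relation symbols: one binary symbol for each colour. -/
inductive ColourRel : ℕ → Type
  | colour (m : ℕ) : ColourRel 2

/-- The language of edge-colourings by countably many colours. -/
def colourLanguage : FirstOrder.Language.{0, 0} := ⟨fun _ => Empty, ColourRel⟩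

instance : colourLanguage.IsRelational := fun _ => inferInstanceAs (IsEmpty Empty)

theorem exists_surjective_finsupp : ∃ d : ℕ → (ℕ →₀ ℕ), Function.Surjective d :=
  exists_surjective_nat _

/-- The colours of the edges from `j` to smaller numbers; every finitely supported pattern occurs
for arbitrarily large `j`. -/
noncomputable def edgePattern (j : ℕ) : ℕ →₀ ℕ :=
  exists_surjective_finsupp.choose (Nat.unpair j).1

theorem exists_edgePattern_eq (t : ℕ →₀ ℕ) (N : ℕ) : ∃ j, N ≤ j ∧ edgePattern j = t := by
  obtain ⟨k, hk⟩ := exists_surjective_finsupp.choose_spec t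
  -- The second coordinate is padding that makes `j` large.
  exact ⟨Nat.pair k N, Nat.right_le_pair k N, by rw [edgePattern, Nat.unpair_pair]; exact hk⟩

/-- The colour of an edge of the random edge-colouring on `ℕ`; the value `0` stands for an
uncoloured pair. -/
noncomputable def edgeColour (i j : ℕ) : ℕ :=
  if i < j then edgePattern j i else if j < i then edgePattern i j else 0

theorem edgeColour_self (i : ℕ) : edgeColour i i = 0 := by simp [edgeColour]

theorem edgeColour_comm (i j : ℕ) : edgeColour i j = edgeColour j i := by
  unfold edgeColour
  rcases lt_trichotomy i j with h | rfl | h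
  · rw [if_pos h, if_neg h.not_gt, if_pos h]
  · rfl
  · rw [if_pos h, if_neg h.not_gt, if_pos h]

/-- The extension property of the random edge-colouring. -/
theorem exists_edgeColour_eq (S : Finset ℕ) (t : ℕ → ℕ) :
    ∃ z ∉ S, ∀ s ∈ S, edgeColour z s = t s := by
  obtain ⟨z, hz, ht⟩ := exists_edgePattern_eq
    (Finsupp.onFinset S (fun i => if i ∈ S then t i else 0) fun i hi => by
      by_contra h
      exact hi (if_neg h)) (S.sup id + 1)
  -- With `z` above all of `S`, the colours from `z` to `S` are read off from the pattern of `z`.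
  have hlt : ∀ s ∈ S, s < z := fun s hs => lt_of_lt_of_le
    (Nat.lt_succ_of_le (Finset.le_sup (f := id) hs)) hz
  refine ⟨z, fun h => (hlt z h).ne rfl, fun s hs => ?_⟩
  rw [edgeColour, if_neg (hlt s hs).not_gt, if_pos (hlt s hs), ht, Finsupp.onFinset_apply,
    if_pos hs]

/-- The random edge-colouring as a structure. -/
instance edgeColourStructure : colourLanguage.Structure ℕ where
  funMap := fun f => isEmptyElim f
  RelMap := fun R x => match R with
    | .colour m => edgeColour (x 0) (x 1) = m + 1

theorem relMap_colour (m : ℕ) (x : Fin 2 → ℕ) :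
    Structure.RelMap (L := colourLanguage) (ColourRel.colour m : colourLanguage.Relations 2) x ↔
      edgeColour (x 0) (x 1) = m + 1 := Iff.rfl

theorem eq_of_forall_eq_succ_iff {a b : ℕ} (h : ∀ m, a = m + 1 ↔ b = m + 1) : a = b := by
  cases a with
  | zero =>
    cases b with
    | zero => rfl
    | succ b => exact (h b).2 rfl
  | succ a => exact ((h a).1 rfl).symm

/-- Two embeddings of the same structure induce the same colours. -/
theorem edgeColour_embedding {S : Type*} [colourLanguage.Structure S]
    (e f : S ↪[colourLanguage] ℕ) (x y : S) :
    edgeColour (e x) (e y) = edgeColour (f x) (f y) := by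
  refine eq_of_forall_eq_succ_iff fun m => ?_
  have h := (e.map_rel (ColourRel.colour m : colourLanguage.Relations 2) ![x, y]).trans
    (f.map_rel (ColourRel.colour m : colourLanguage.Relations 2) ![x, y]).symm
  exact h

/-- An injection that induces the colours of a structure is an embedding. -/
def embeddingOfEdgeColour {S : Type*} [colourLanguage.Structure S] (e : S ↪[colourLanguage] ℕ)
    (f : S → ℕ) (hf : Function.Injective f)
    (hc : ∀ x y, edgeColour (f x) (f y) = edgeColour (e x) (e y)) : S ↪[colourLanguage] ℕ where
  toFun := f
  inj' := hf
  map_fun' := fun {_} F => isEmptyElim F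
  map_rel' := fun {_} R x => by
    rw [← e.map_rel]
    cases R with
    | colour m =>
      change edgeColour (f (x 0)) (f (x 1)) = m + 1 ↔ edgeColour (e (x 0)) (e (x 1)) = m + 1
      rw [hc]

/-- By back-and-forth it suffices to extend a finite partial embedding `f` to one more point `m`;
its image `z` has the colours to the range of `f` that `m` has to `S`. -/
theorem isUltrahomogeneous_edgeColour : colourLanguage.IsUltrahomogeneous ℕ := by
  classical
  rw [isUltrahomogeneous_iff_IsExtensionPair Structure.cg_of_countable,
    isExtensionPair_iff_exists_embedding_closure_singleton_sup]
  intro S hS f m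
  have : Finite S := hS.finite
  have hmem : ∀ x ∈ Substructure.closure colourLanguage {m} ⊔ S, x ∉ S → x = m := by
    intro x hx hxS
    rw [← Substructure.closure_eq S, ← Substructure.closure_union,
      Substructure.mem_closure_iff_of_isRelational] at hx
    exact hx.resolve_right hxS
  obtain ⟨z, hz, hzc⟩ := exists_edgeColour_eq (Set.finite_range f).toFinset
    (Function.extend f (fun s => edgeColour m s) 0)
  have hzf : ∀ s : S, f s ≠ z := fun s hs => hz (by simp [← hs])
  have hzc' : ∀ s : S, edgeColour z (f s) = edgeColour m s := fun s => by
    rw [hzc (f s) (by simp), f.injective.extend_apply]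
  have hff : ∀ s s' : S, edgeColour (f s) (f s') = edgeColour s s' :=
    edgeColour_embedding f S.subtype
  let g : (Substructure.closure colourLanguage {m} ⊔ S : colourLanguage.Substructure ℕ) → ℕ :=
    fun x => if hx : (x : ℕ) ∈ S then f ⟨x, hx⟩ else z
  have hg : ∀ (x : (Substructure.closure colourLanguage {m} ⊔ S : colourLanguage.Substructure ℕ))
      (hx : (x : ℕ) ∈ S), g x = f ⟨x, hx⟩ := fun x hx => dif_pos hx
  have hg' : ∀ (x : (Substructure.closure colourLanguage {m} ⊔ S : colourLanguage.Substructure ℕ)),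
      (x : ℕ) ∉ S → g x = z := fun x hx => dif_neg hx
  refine ⟨embeddingOfEdgeColour (Substructure.subtype _) g ?_ ?_, ?_⟩
  · intro x y hxy
    by_cases hx : (x : ℕ) ∈ S <;> by_cases hy : (y : ℕ) ∈ S
    · rw [hg x hx, hg y hy] at hxy
      exact Subtype.ext (Subtype.mk.inj (f.injective hxy))
    · rw [hg x hx, hg' y hy] at hxy
      exact absurd hxy (hzf _)
    · rw [hg' x hx, hg y hy] at hxy
      exact absurd hxy.symm (hzf _)
    · exact Subtype.ext ((hmem x x.2 hx).trans (hmem y y.2 hy).symm)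
  · intro x y
    change _ = edgeColour (x : ℕ) (y : ℕ)
    by_cases hx : (x : ℕ) ∈ S <;> by_cases hy : (y : ℕ) ∈ S
    · rw [hg x hx, hg y hy, hff]
    · rw [hg x hx, hg' y hy, edgeColour_comm, hzc', hmem y y.2 hy, edgeColour_comm]
    · rw [hg' x hx, hg y hy, hzc', hmem x x.2 hx]
    · rw [hg' x hx, hg' y hy, hmem x x.2 hx, hmem y y.2 hy, edgeColour_self, edgeColour_self]
  · ext s
    exact (hg ⟨s, _⟩ s.2).symm

/-! ### Free amalgamation of edge-colourings -/

/-- A finite set `D` can be moved over `A` so that it has no edges to `F \ A`. -/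
theorem exists_free_move (A F D : Finset ℕ) (hAD : Disjoint A D) :
    ∃ r : ℕ → ℕ, (∀ a ∈ A, r a = a) ∧ (∀ x ∈ D, r x ∉ F) ∧ Set.InjOn r (A ∪ D : Finset ℕ) ∧
      (∀ x ∈ A ∪ D, ∀ y ∈ A ∪ D, edgeColour (r x) (r y) = edgeColour x y) ∧
      ∀ x ∈ D, ∀ y ∈ F, y ∉ A → edgeColour (r x) y = 0 := by
  classical
  induction D using Finset.induction_on with
  | empty => exact ⟨id, by simp, by simp, Function.injective_id.injOn, by simp, by simp⟩
  | insert x D hx ih =>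
    rw [Finset.disjoint_insert_right] at hAD
    obtain ⟨hxA, hAD⟩ := hAD
    obtain ⟨r, hrA, hrF, hinj, hcol, hzero⟩ := ih hAD
    -- The image `z` of `x` copies the colours of `x` on points already placed and is joined to
    -- nothing else in `F`; the placed points in `F` are exactly those of `A` in `F`.
    obtain ⟨z, hz, hzc⟩ := exists_edgeColour_eq (F ∪ (A ∪ D).image r)
      (fun w => if w ∈ (A ∪ D).image r then
        edgeColour x (Function.invFunOn r (A ∪ D : Finset ℕ) w) else 0)
    rw [Finset.notMem_union] at hz
    have hxAD : x ∉ A ∪ D := by simp [hxA, hx]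
    have hzr : ∀ y ∈ A ∪ D, edgeColour z (r y) = edgeColour x y := by
      intro y hy
      have hyi : r y ∈ (A ∪ D).image r := Finset.mem_image_of_mem r hy
      rw [hzc _ (Finset.mem_union_right _ hyi), if_pos hyi]
      congr 1
      exact hinj (Function.invFunOn_mem ⟨y, hy, rfl⟩) hy (Function.invFunOn_eq ⟨y, hy, rfl⟩)
    have hzF : ∀ y ∈ F, y ∉ A → edgeColour z y = 0 := by
      intro y hy hyA
      rw [hzc _ (Finset.mem_union_left _ hy), if_neg]
      rw [Finset.mem_image]
      rintro ⟨w, hw, rfl⟩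
      rcases Finset.mem_union.1 hw with hw | hw
      · exact hyA ((hrA w hw).symm ▸ hw)
      · exact hrF w hw hy
    have hne : ∀ y ∈ A ∪ D, y ≠ x := fun y hy h => hxAD (h ▸ hy)
    have hup : ∀ y ∈ A ∪ D, Function.update r x z y = r y := fun y hy =>
      Function.update_of_ne (hne y hy) _ _
    have hupx : Function.update r x z x = z := Function.update_self _ _ _
    have hzr' : ∀ y ∈ A ∪ D, r y ≠ z := fun y hy h => hz.2 (h ▸ Finset.mem_image_of_mem r hy)
    rw [Finset.union_insert]
    refine ⟨Function.update r x z, fun a ha => ?_, fun y hy => ?_, ?_, ?_, ?_⟩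
    · rw [hup a (Finset.mem_union_left _ ha), hrA a ha]
    · rcases Finset.mem_insert.1 hy with rfl | hy
      · rw [hupx]
        exact hz.1
      · rw [hup y (Finset.mem_union_right _ hy)]
        exact hrF y hy
    · intro a ha₀ b hb₀ hab
      rcases Finset.mem_insert.1 ha₀ with rfl | ha <;>
        rcases Finset.mem_insert.1 hb₀ with rfl | hb
      · rfl
      · rw [hupx, hup b hb] at hab
        exact absurd hab.symm (hzr' b hb)
      · rw [hupx, hup a ha] at hab
        exact absurd hab (hzr' a ha)
      · rw [hup a ha, hup b hb] at hab
        exact hinj ha hb hab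
    · intro a ha₀ b hb₀
      rcases Finset.mem_insert.1 ha₀ with rfl | ha <;>
        rcases Finset.mem_insert.1 hb₀ with rfl | hb
      · rw [edgeColour_self, edgeColour_self]
      · rw [hupx, hup b hb, hzr b hb]
      · rw [hupx, hup a ha, edgeColour_comm, hzr a ha, edgeColour_comm]
      · rw [hup a ha, hup b hb, hcol a ha b hb]
    · intro a ha y hy hyA
      rcases Finset.mem_insert.1 ha with rfl | ha
      · rw [hupx, hzF y hy hyA]
      · rw [hup a (Finset.mem_union_right _ ha), hzero a ha y hy hyA]

theorem hasFreeAmalgamation_edgeColour : HasFreeAmalgamation colourLanguage ℕ := by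
  classical
  rintro A B₁ B₂ f₁ f₂ ⟨hA, -⟩ ⟨hB₁, ⟨e₁⟩⟩ ⟨hB₂, ⟨e₂⟩⟩
  have : Finite A := hA.finite
  have : Finite B₁ := hB₁.finite
  have : Finite B₂ := hB₂.finite
  -- Ultrahomogeneity makes the two copies of `A` coincide; then the rest of `B₂` is moved off `B₁`,
  -- and the amalgam is the union.
  obtain ⟨e₃, he₃⟩ : ∃ e₃ : B₂ ↪[colourLanguage] ℕ, ∀ a, e₃ (f₂ a) = e₁ (f₁ a) := by
    have : Nonempty (B₂ ↪[colourLanguage] ℕ) := ⟨e₂⟩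
    obtain ⟨e₃, he₃⟩ := isUltrahomogeneous_edgeColour.extend_embedding hA (e₁.comp f₁) f₂
    exact ⟨e₃, fun a => (congrArg (fun u : A ↪[colourLanguage] ℕ => u a) he₃).symm⟩
  let A₀ : Finset ℕ := (Set.finite_range (e₁ ∘ f₁)).toFinset
  let F : Finset ℕ := (Set.finite_range e₁).toFinset
  let D : Finset ℕ := (Set.finite_range e₃).toFinset
  have hA₀ : ∀ x, x ∈ A₀ ↔ ∃ a, e₁ (f₁ a) = x := fun x => by simp [A₀]
  have hF : ∀ x, x ∈ F ↔ ∃ b, e₁ b = x := fun x => by simp [F]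
  have hD : ∀ x, x ∈ D ↔ ∃ b, e₃ b = x := fun x => by simp [D]
  have hA₀F : A₀ ⊆ F := fun x hx => by
    obtain ⟨a, rfl⟩ := (hA₀ x).1 hx
    exact (hF _).2 ⟨f₁ a, rfl⟩
  obtain ⟨r, hrA, hrF, hinj, hcol, hzero⟩ :=
    exists_free_move A₀ F (D \ A₀) Finset.disjoint_sdiff
  have hmem : ∀ b, e₃ b ∈ A₀ ∪ D \ A₀ := fun b => by
    rw [Finset.union_sdiff_self_eq_union]
    exact Finset.mem_union_right _ ((hD _).2 ⟨b, rfl⟩)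
  let g : B₂ ↪[colourLanguage] ℕ := embeddingOfEdgeColour e₃ (fun b => r (e₃ b))
    (fun b b' h => e₃.injective (hinj (hmem b) (hmem b') h))
    (fun b b' => hcol _ (hmem b) _ (hmem b'))
  have hg : ∀ b, g b = r (e₃ b) := fun _ => rfl
  have hgA : ∀ a, g (f₂ a) = e₁ (f₁ a) := fun a => by
    rw [hg, he₃, hrA _ ((hA₀ _).2 ⟨a, rfl⟩)]
  have hgF : ∀ b, g b ∈ F → ∃ a, f₂ a = b := by
    intro b hb
    by_cases h : e₃ b ∈ A₀
    · obtain ⟨a, ha⟩ := (hA₀ _).1 h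
      exact ⟨a, e₃.injective ((he₃ a).trans ha)⟩
    · exact absurd hb (hrF _ (Finset.mem_sdiff.2 ⟨(hD _).2 ⟨b, rfl⟩, h⟩))
  have hgzero : ∀ b, g b ∉ F → ∀ y ∈ F, y ∉ A₀ → edgeColour (g b) y = 0 := by
    intro b hb y hy hyA
    refine hzero _ (Finset.mem_sdiff.2 ⟨(hD _).2 ⟨b, rfl⟩, fun h => hb ?_⟩) y hy hyA
    rw [hg, hrA _ h]
    exact hA₀F h
  let S : colourLanguage.Substructure ℕ :=
    Substructure.closure colourLanguage (Set.range e₁ ∪ Set.range g)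
  have hS : ∀ x, x ∈ S ↔ x ∈ Set.range e₁ ∪ Set.range g :=
    Substructure.mem_closure_iff_of_isRelational colourLanguage _
  let g₁ : B₁ ↪[colourLanguage] S := e₁.codRestrict S fun b => (hS _).2 (.inl ⟨b, rfl⟩)
  let g₂ : B₂ ↪[colourLanguage] S := g.codRestrict S fun b => (hS _).2 (.inr ⟨b, rfl⟩)
  have hg₁ : ∀ b, (g₁ b : ℕ) = e₁ b := fun _ => rfl
  have hg₂ : ∀ b, (g₂ b : ℕ) = g b := fun _ => rfl
  refine ⟨⟨S, inferInstance⟩, g₁, g₂, age.fg_substructure (Substructure.fg_closure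
    ((Set.finite_range _).union (Set.finite_range _))), ?_, ?_, ?_⟩
  · ext a
    exact (hgA a).symm
  · intro b₁ b₂ h
    have h' : e₁ b₁ = g b₂ := congrArg Subtype.val h
    obtain ⟨a, rfl⟩ := hgF b₂ ((hF _).2 ⟨b₁, h'⟩)
    exact ⟨a, e₁.injective ((hgA a).symm.trans h'.symm), rfl⟩
  · intro n R c hR
    cases R with
    | colour m =>
      have hRc : edgeColour (c 0 : S) (c 1 : S) = m + 1 := hR
      have hedge : ∀ x y : S, edgeColour x y = m + 1 →
          (x ∈ Set.range g₁ ∧ y ∈ Set.range g₁) ∨ (x ∈ Set.range g₂ ∧ y ∈ Set.range g₂) := by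
        -- A coloured edge leaving `F` must start in `A₀`, which lies in both copies, since all
        -- other such pairs have colour `0`.
        have aux : ∀ x y : S, edgeColour x y = m + 1 → (x : ℕ) ∈ F → (y : ℕ) ∉ F →
            x ∈ Set.range g₂ ∧ y ∈ Set.range g₂ := by
          intro x y hxy hx hy
          obtain ⟨b, hb⟩ := ((hS y).1 y.2).resolve_left fun h => hy ((hF _).2 h)
          refine ⟨?_, ⟨b, Subtype.ext hb⟩⟩
          by_contra hcon
          have hxA : (x : ℕ) ∉ A₀ := fun h => by
            obtain ⟨a, ha⟩ := (hA₀ _).1 h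
            exact hcon ⟨f₂ a, Subtype.ext ((hgA a).trans ha)⟩
          have h0 := hgzero b (hb ▸ hy) x hx hxA
          rw [hb, edgeColour_comm, hxy] at h0
          exact absurd h0 (Nat.succ_ne_zero m)
        have mem₁ : ∀ x : S, (x : ℕ) ∈ F → x ∈ Set.range g₁ := fun x hx => by
          obtain ⟨b, hb⟩ := (hF _).1 hx
          exact ⟨b, Subtype.ext hb⟩
        have mem₂ : ∀ x : S, (x : ℕ) ∉ F → x ∈ Set.range g₂ := fun x hx => by
          obtain ⟨b, hb⟩ := ((hS x).1 x.2).resolve_left fun h => hx ((hF _).2 h)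
          exact ⟨b, Subtype.ext hb⟩
        intro x y hxy
        by_cases hx : (x : ℕ) ∈ F <;> by_cases hy : (y : ℕ) ∈ F
        · exact .inl ⟨mem₁ x hx, mem₁ y hy⟩
        · exact .inr (aux x y hxy hx hy)
        · exact .inr (aux y x ((edgeColour_comm _ _).trans hxy) hy hx).symm
        · exact .inr ⟨mem₂ x hx, mem₂ y hy⟩
      exact (hedge _ _ hRc).imp (fun h i => by fin_cases i; exacts [h.1, h.2])
        (fun h i => by fin_cases i; exacts [h.1, h.2])

/-! ### Failure of Roelcke precompactness -/

theorem edgeColour_of_mem_autGroup {g : Equiv.Perm ℕ} (hg : g ∈ autGroup colourLanguage ℕ)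
    (x y : ℕ) : edgeColour (g x) (g y) = edgeColour x y := by
  obtain ⟨φ, rfl⟩ := hg
  exact edgeColour_embedding φ.toEmbedding (Embedding.refl colourLanguage ℕ) x y

/-- There are no loops, so all one-point substructures are isomorphic. -/
theorem exists_mem_autGroup_apply_zero (y : ℕ) : ∃ g ∈ autGroup colourLanguage ℕ, g 0 = y := by
  obtain ⟨g, hg, hgy⟩ := exists_mem_autGroup_eqOn isUltrahomogeneous_edgeColour
    (Set.finite_singleton 0) (fun _ => y) (Set.injOn_singleton _ _) (fun n R x hx => by
      cases R with
      | colour m =>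
        rw [relMap_colour, relMap_colour, hx 0, hx 1, edgeColour_self]
        exact iff_of_eq (congrArg (· = m + 1) (edgeColour_self y)))
  exact ⟨g, hg, hgy rfl⟩

theorem isOpen_setOf_apply_eq (G : Subgroup (Equiv.Perm ℕ)) (x y : ℕ) :
    IsOpen {g : G | (g : Equiv.Perm ℕ) x = y} := by
  have h1 : Continuous fun g : Equiv.Perm ℕ => (g : ℕ → ℕ) := continuous_induced_dom
  have h2 : Continuous fun g : G => (g : Equiv.Perm ℕ) x :=
    (continuous_apply x).comp (h1.comp continuous_subtype_val)
  exact (isOpen_discrete {y}).preimage h2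

theorem not_isRoelckePrecompact_edgeColour :
    ¬ IsRoelckePrecompact (autGroup colourLanguage ℕ) := by
  intro h
  obtain ⟨F, hF, hUFU⟩ := h {g | (g : Equiv.Perm ℕ) 0 = 0}
    ((isOpen_setOf_apply_eq _ 0 0).mem_nhds rfl)
  -- A value of `edgeColour 0 (f 0)` missed by all `f ∈ F`. Multiplying `f` on both sides by
  -- elements fixing `0` preserves this value.
  obtain ⟨m, hm⟩ := Infinite.exists_notMem_finset
    (hF.image fun g : autGroup colourLanguage ℕ =>
      edgeColour 0 ((g : Equiv.Perm ℕ) 0)).toFinset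
  obtain ⟨z, -, hz⟩ := exists_edgeColour_eq {0} fun _ => m
  obtain ⟨g, hg, rfl⟩ := exists_mem_autGroup_apply_zero z
  have hmem : (⟨g, hg⟩ : autGroup colourLanguage ℕ) ∈
      {g : autGroup colourLanguage ℕ | (g : Equiv.Perm ℕ) 0 = 0} * F *
        {g : autGroup colourLanguage ℕ | (g : Equiv.Perm ℕ) 0 = 0} := hUFU ▸ Set.mem_univ _
  obtain ⟨_, ⟨a, ha, f, hf, rfl⟩, b, hb, hab⟩ := hmem
  have hg0 : g 0 = (a : Equiv.Perm ℕ) ((f : Equiv.Perm ℕ) 0) := by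
    have h1 : g 0 = (a : Equiv.Perm ℕ) ((f : Equiv.Perm ℕ) ((b : Equiv.Perm ℕ) 0)) :=
      congrArg (fun k : autGroup colourLanguage ℕ => (k : Equiv.Perm ℕ) 0) hab.symm
    rw [h1, show (b : Equiv.Perm ℕ) 0 = 0 from hb]
  refine hm ((Set.Finite.mem_toFinset _).2 ⟨f, hf, ?_⟩)
  have ha' : (a : Equiv.Perm ℕ) 0 = 0 := ha
  have h2 := edgeColour_of_mem_autGroup a.2 0 ((f : Equiv.Perm ℕ) 0)
  rw [ha', ← hg0, edgeColour_comm, hz 0 (Finset.mem_singleton_self 0)] at h2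
  exact h2.symm

end EdgeColouring

end Dissociation

theorem mainTheorem11 :
    (∀ (L : FirstOrder.Language.{u, v}) [L.IsRelational] (M : Type w) [L.Structure M]
      [Countable M] (K : Set (CategoryTheory.Bundled.{w} L.Structure)),
      FirstOrder.Language.IsFraisseLimit K M → Dissociation.HasFreeAmalgamation L M →
        Dissociation.IsDissociated.{w, uH, uX} (Dissociation.autGroup L M)) ∧
    (∃ (L : FirstOrder.Language.{0, 0}) (_ : L.IsRelational) (M : Type) (_ : L.Structure M)
      (_ : Countable M) (K : Set (CategoryTheory.Bundled.{0} L.Structure)),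
      FirstOrder.Language.IsFraisseLimit K M ∧ Dissociation.HasFreeAmalgamation L M ∧
        ¬ Dissociation.IsRoelckePrecompact (Dissociation.autGroup L M)) := by
  refine ⟨fun L _ M _ _ K hK hfree => ⟨?_, ?_⟩, ?_⟩
  · intro H _ _ _ π
    exact π.isDissociated_of_hasFreeAmalgamation hK.ultrahomogeneous hfree
  · intro X _ _ μ _ α
    exact α.isDissociated_of_hasFreeAmalgamation hK.ultrahomogeneous hfree
  · exact ⟨Dissociation.colourLanguage, inferInstance, ℕ, inferInstance, inferInstance,
      Dissociation.colourLanguage.age ℕ, ⟨Dissociation.isUltrahomogeneous_edgeColour, rfl⟩,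
      Dissociation.hasFreeAmalgamation_edgeColour,
      Dissociation.not_isRoelckePrecompact_edgeColour⟩
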